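/- Let $p$ be a prime and let $\bar r=(r^1,r^2)\in\mathbb R^2$ with $r^1,r^2\ge 0$ and $r^1+r^2=1$. Let $\mathbf{Bad}^{\bar r}_{\mathbb Z_p^2}$ be the set of points $\bar x=(x_1,x_2)\in\mathbb Z_p^2$ for which there is a constant $c=c(\bar x)>0$ such that $$\max_{i=1,2}\Big|x_i-\frac{z_i}{q}\Big|_p^{1/(1+r^i)}\ \ge\ \frac{c}{\max\{|z_1|,|z_2|,|q|\}}\qquad\text{for all } (z_1,z_2)\in\mathbb Z^2 \text{ and all integers } q\ge 1.$$ For $\bar x\in\mathbb Z_p^2$ and $t>0$ let $$\psi(\bar x,t)=\{\bar y\in\mathbb Z_p^2:\ |y_i-x_i|_p\le e^{-(1+r^i)t}\text{ for } i=1,2\},$$ and for $Y\subset\mathbb Z_p^2$ let $\psi(Y,t)=\bigcup_{\bar y\in Y}\psi(\bar y,t)$. Let $\mathcal S$ be the collection of $p$-adic lines in $\mathbb Z_p^2$, that is, of the sets $L\cap\mathbb Z_p^2$ with $L$ an affine line in $\mathbb Q_p^2$. A set $S\subset\mathbb Z_p^2$ is called absolute $\psi$-winning with respect to $\mathcal S$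 if there is $b_*>0$ such that, for every $b\ge b_*$, player $A$ has a winning strategy in the following game. Player $B$ first chooses a pair $\omega_1=(\bar x_1,t_1)\in\mathbb Z_p^2\times(0,\infty)$. When $B$ has chosen $\omega_k=(\bar x_k,t_k)$, player $A$ chooses a set $A_k$ which is either empty or of the form $\psi(S_k,t_k+a_k)$ with $S_k\in\mathcal S$ and $a_k\ge b$; then $B$ chooses a pair $\omega_{k+1}=(\bar x_{k+1},t_k+\bar b)$ with $b_*\le\bar b\le b$ and $\psi(\omega_{k+1})\subset\psi(\omega_k)\setminus A_k$. Player $A$ may only choose sets $A_k$ for which $B$ has at least one such move. Player $A$ wins if $\bigcap_{k\ge1}\psi(\omega_k)$ intersects $S$. Then $\mathbf{Bad}^{\bar r}_{\mathbb Z_p^2}$ is absolute $\psi$-winning with respect to $\mathcal S$. Moreover it is thick: for every nonempty open set $U\subset\mathbb Z_p^2$, $$\dim\big(\mathbf{Bad}^{\bar r}_{\mathbb Z_p^2}\cap U\big)=2,$$ where $\dim$ is the Hausdorff dimension with respect to the metric $\max_{i=1,2}|x_i-y_i|_p$. -/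

import Mathlib

namespace AbsGame

variable {X : Type*}

/-- Formal balls `(x, t)` with center `x` and parameter `t` in `(0, ∞)`. -/
abbrev FBall (X : Type*) := X × Set.Ioi (0 : ℝ)

/-- The `ψ`-neighborhood `ψ(Y, t)`, the union of the sets `ψ(y, t)` over `y ∈ Y`. -/
def nhd (ψ : X → ℝ → Set X) (Y : Set X) (t : ℝ) : Set X :=
  ⋃ y ∈ Y, ψ y t

/-- The sets which player A may block when player B has just chosen the formal ball `ω`:
the empty set, or a neighborhood `ψ(L, t + a)` with `L ∈ 𝓛` and `a ≥ b`, where `ω = (x, t)`. -/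
def CanBlock (ψ : X → ℝ → Set X) (𝓛 : Set (Set X)) (b : ℝ) (ω : FBall X) (A : Set X) : Prop :=
  A = ∅ ∨ ∃ L ∈ 𝓛, ∃ a : ℝ, b ≤ a ∧ A = nhd ψ L ((ω.2 : ℝ) + a)

/-- The legal moves of player B after `ω = (x, t)` when A blocks the set `A`: the formal balls
`ω' = (x', t + b')` with `b₀ ≤ b' ≤ b` and `ψ(ω') ⊆ ψ(ω) \ A`. -/
def legalMoves (ψ : X → ℝ → Set X) (b₀ b : ℝ) (ω : FBall X) (A : Set X) : Set (FBall X) :=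
  {ω' | ∃ b' : ℝ, b₀ ≤ b' ∧ b' ≤ b ∧ (ω'.2 : ℝ) = (ω.2 : ℝ) + b' ∧
    ψ ω'.1 ω'.2 ⊆ ψ ω.1 ω.2 \ A}

/-- A strategy of player A: after B has chosen the formal balls `h 0, …, h k`, the strategy
tells A to block the set `σ k h`. -/
abbrev Strategy (X : Type*) := (k : ℕ) → (Fin (k + 1) → FBall X) → Set X

/-- The strategy obeys the rules: it blocks only sets that A may block, and it always leaves
player B at least one legal move. (On histories that never occur, A can always block `∅`.) -/
def Strategy.Obeys (σ : Strategy X) (ψ : X → ℝ → Set X) (𝓛 : Set (Set X)) (b₀ b : ℝ) : Prop :=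
  ∀ (k : ℕ) (h : Fin (k + 1) → FBall X),
    CanBlock ψ 𝓛 b (h (Fin.last k)) (σ k h) ∧
      (legalMoves ψ b₀ b (h (Fin.last k)) (σ k h)).Nonempty

/-- The sequence `ω` of B's choices is a play of the game in which A follows `σ`. -/
def Strategy.IsPlay (σ : Strategy X) (ψ : X → ℝ → Set X) (b₀ b : ℝ) (ω : ℕ → FBall X) : Prop :=
  ∀ k : ℕ, ω (k + 1) ∈ legalMoves ψ b₀ b (ω k) (σ k fun i => ω i)

/-- `S` is absolute `(ψ, b₀, b)`-winning with respect to `𝓛`: player A has a strategy such that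
`⋂ k, ψ(ω k)` meets `S` for every play `ω`. -/
def IsAbsWinningWith (ψ : X → ℝ → Set X) (𝓛 : Set (Set X)) (b₀ b : ℝ) (S : Set X) : Prop :=
  ∃ σ : Strategy X, σ.Obeys ψ 𝓛 b₀ b ∧
    ∀ ω : ℕ → FBall X, σ.IsPlay ψ b₀ b ω →
      ((⋂ k, ψ (ω k).1 (ω k).2) ∩ S).Nonempty

/-- `S` is absolute `ψ`-winning with respect to `𝓛`: for some `b₀ > 0` it is absolute
`(ψ, b₀, b)`-winning with respect to `𝓛` for every `b ≥ b₀`. -/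
def IsAbsWinning (ψ : X → ℝ → Set X) (𝓛 : Set (Set X)) (S : Set X) : Prop :=
  ∃ b₀ : ℝ, 0 < b₀ ∧ ∀ b : ℝ, b₀ ≤ b → IsAbsWinningWith ψ 𝓛 b₀ b S

end AbsGame

/-- The box `ψ(x, t)` in `ℤ_p²`, the product of the closed balls of radius
`exp (-(1 + r i) t)` about `x i`, for `i = 0, 1`. -/
def padicBox (p : ℕ) [Fact p.Prime] (r : Fin 2 → ℝ) (x : Fin 2 → ℤ_[p]) (t : ℝ) :
    Set (Fin 2 → ℤ_[p]) :=
  {y | ∀ i, y i ∈ Metric.closedBall (x i) (Real.exp (-(1 + r i) * t))}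

/-- The `p`-adic lines in `ℤ_p²`: the intersections of `ℤ_p²` with the affine lines of `ℚ_p²`. -/
def padicLines (p : ℕ) [Fact p.Prime] : Set (Set (Fin 2 → ℤ_[p])) :=
  {S | ∃ L : AffineSubspace ℚ_[p] (Fin 2 → ℚ_[p]), Module.finrank ℚ_[p] L.direction = 1 ∧
    S = {y | (fun i => (y i : ℚ_[p])) ∈ L}}

/-- The badly approximable vectors of `ℤ_p²` with weights `r`. -/
def padicBad (p : ℕ) [Fact p.Prime] (r : Fin 2 → ℝ) : Set (Fin 2 → ℤ_[p]) :=
  {x | ∃ c : ℝ, 0 < c ∧ ∀ (z : Fin 2 → ℤ) (q : ℕ), 0 < q →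
    c * (max (max |(z 0 : ℝ)| |(z 1 : ℝ)|) |(q : ℝ)|)⁻¹ ≤
      max (‖(x 0 : ℚ_[p]) - (z 0 : ℚ_[p]) / (q : ℚ_[p])‖ ^ (1 / (1 + r 0)))
        (‖(x 1 : ℚ_[p]) - (z 1 : ℚ_[p]) / (q : ℚ_[p])‖ ^ (1 / (1 + r 1)))}

/-! The sets `ψ(x, t)` are products of residue classes, so two of them with the same `t` are equal
or disjoint. By the simplex lemma (`lowRationals_cross_eq`), the rational points of such a box with
height below `exp t / 2` lie on one line. A blocks the `ψ`-neighborhood of that line at parameter `t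
+ b`. Since `t` grows by at most `b` per move and tends to infinity, every height is handled at a
comparable scale, and every point in the intersection of the boxes is in Bad
(`mem_padicBad_of_forall_notMem`). B is never stuck: a line misses a sub-box one level deeper
(`exists_congrBox_disjoint_padicLine`).

For the dimension, suppose Bad has zero Hausdorff measure of exponent `2 - 2/M` in a box. Weight
Haar measure on a cheap cover by cubes to get a measure `ν`. B plays with `b = M * log p`, choosing
sub-boxes of least `ν`-measure, so the density of `ν` relative to Haar measure grows by at most `p ^
2` per move, whatever `M` is (`exists_legal_measure_le`). The resulting point of Bad lies in a cube
of the cover, where the weight forces a larger density: a contradiction. Let `M` tend to infinity.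
-/

open Set

/-! ### Boxes as residue classes, and lines that miss sub-boxes -/

section CongruenceBoxes

variable {p : ℕ} [Fact p.Prime]

/-- The product of the residue classes of `x i` modulo `p ^ n i`. -/
def congrBox (x : Fin 2 → ℤ_[p]) (n : Fin 2 → ℕ) : Set (Fin 2 → ℤ_[p]) :=
  {y | ∀ i, (p : ℤ_[p]) ^ n i ∣ y i - x i}

theorem mem_congrBox_self (x : Fin 2 → ℤ_[p]) (n : Fin 2 → ℕ) : x ∈ congrBox x n := by
  simp [congrBox]

theorem congrBox_anti (x : Fin 2 → ℤ_[p]) {m n : Fin 2 → ℕ} (h : m ≤ n) :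
    congrBox x n ⊆ congrBox x m :=
  fun _ hy i => (pow_dvd_pow _ (h i)).trans (hy i)

theorem congrBox_eq_of_mem {x y : Fin 2 → ℤ_[p]} {n : Fin 2 → ℕ} (h : y ∈ congrBox x n) :
    congrBox y n = congrBox x n := by
  ext z
  refine forall_congr' fun i => ?_
  have := h i
  rw [← dvd_add_left this, sub_add_sub_cancel]

theorem mem_congrBox_comm {x y : Fin 2 → ℤ_[p]} {n : Fin 2 → ℕ} :
    y ∈ congrBox x n ↔ x ∈ congrBox y n :=
  forall_congr' fun _ => dvd_sub_comm

theorem congrBox_subset_of_mem {x y : Fin 2 → ℤ_[p]} {m n : Fin 2 → ℕ} (h : y ∈ congrBox x m)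
    (hmn : m ≤ n) : congrBox y n ⊆ congrBox x m :=
  congrBox_eq_of_mem h ▸ congrBox_anti y hmn

theorem PadicInt.norm_le_pow_iff_pow_dvd (y : ℤ_[p]) (n : ℕ) :
    ‖y‖ ≤ (p : ℝ) ^ (-n : ℤ) ↔ (p : ℤ_[p]) ^ n ∣ y := by
  rw [PadicInt.norm_le_pow_iff_mem_span_pow, Ideal.mem_span_singleton]

theorem log_prime_pos (p : ℕ) [hp : Fact p.Prime] : 0 < Real.log p :=
  Real.log_pos (by exact_mod_cast hp.out.one_lt)

/-- Nonzero norms are integral powers of `p`, so a real radius rounds to an integral exponent. -/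
theorem PadicInt.norm_le_exp_iff_pow_dvd (y : ℤ_[p]) (s : ℝ) :
    ‖y‖ ≤ Real.exp (-s) ↔ (p : ℤ_[p]) ^ ⌈s / Real.log p⌉₊ ∣ y := by
  rw [← PadicInt.norm_le_pow_iff_pow_dvd]
  have hp : (0 : ℝ) < p := by exact_mod_cast (Fact.out : p.Prime).pos
  rcases eq_or_ne y 0 with rfl | hy
  · simp only [norm_zero]
    exact iff_of_true (by positivity) (by positivity)
  · have h1 : ‖y‖ = Real.exp (-(y.valuation * Real.log p)) := by
      rw [PadicInt.norm_eq_zpow_neg_valuation hy, ← Real.rpow_intCast, Real.rpow_def_of_pos hp]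
      congr 1
      push_cast
      ring
    rw [PadicInt.norm_le_pow_iff_le_valuation y hy, h1, Real.exp_le_exp, neg_le_neg_iff,
      Nat.ceil_le, div_le_iff₀ (log_prime_pos p)]

/-- The exponents of the congruence box `ψ(x, t)`. -/
noncomputable def boxDepth (p : ℕ) (r : Fin 2 → ℝ) (t : ℝ) (i : Fin 2) : ℕ :=
  ⌈(1 + r i) * t / Real.log p⌉₊

theorem padicBox_eq_congrBox (r : Fin 2 → ℝ) (x : Fin 2 → ℤ_[p]) (t : ℝ) :
    padicBox p r x t = congrBox x (boxDepth p r t) := by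
  ext y
  refine forall_congr' fun i => ?_
  rw [mem_closedBall_iff_norm, neg_mul, PadicInt.norm_le_exp_iff_pow_dvd, boxDepth]

theorem boxDepth_mono {r : Fin 2 → ℝ} (hr : ∀ i, 0 ≤ r i) {s t : ℝ} (h : s ≤ t) :
    boxDepth p r s ≤ boxDepth p r t := fun i => by
  have := log_prime_pos p
  have := hr i
  unfold boxDepth
  gcongr

theorem boxDepth_add_one_le {r : Fin 2 → ℝ} (hr : ∀ i, 0 ≤ r i) {t b : ℝ} (ht : 0 ≤ t)
    (hb : Real.log p ≤ b) : boxDepth p r t + 1 ≤ boxDepth p r (t + b) := fun i => by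
  have hlog := log_prime_pos p
  have := hr i
  simp only [boxDepth, Pi.add_apply, Pi.one_apply]
  rw [← Nat.ceil_add_one (by positivity)]
  refine Nat.ceil_mono ?_
  rw [div_add_one hlog.ne']
  gcongr
  nlinarith

theorem cross_eq_of_mem_line {V : AffineSubspace ℚ_[p] (Fin 2 → ℚ_[p])}
    (hV : Module.finrank ℚ_[p] V.direction = 1) {a b c : Fin 2 → ℚ_[p]} (ha : a ∈ V) (hb : b ∈ V)
    (hc : c ∈ V) : (b 0 - a 0) * (c 1 - a 1) = (b 1 - a 1) * (c 0 - a 0) := by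
  obtain ⟨v, -, hv⟩ := finrank_eq_one_iff'.1 hV
  obtain ⟨s, hs⟩ := hv ⟨b -ᵥ a, AffineSubspace.vsub_mem_direction hb ha⟩
  obtain ⟨t, ht⟩ := hv ⟨c -ᵥ a, AffineSubspace.vsub_mem_direction hc ha⟩
  have hs' := fun i => congrFun (congrArg Subtype.val hs) i
  have ht' := fun i => congrFun (congrArg Subtype.val ht) i
  simp only [Submodule.coe_smul, Pi.smul_apply, smul_eq_mul, vsub_eq_sub, Pi.sub_apply] at hs' ht'
  rw [← hs', ← hs', ← ht', ← ht']
  ring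

/-- A line misses one of the boxes of exponents `n + 1` in a given box of exponents `n`. -/
theorem exists_congrBox_disjoint_padicLine {S : Set (Fin 2 → ℤ_[p])} (hS : S ∈ padicLines p)
    (x : Fin 2 → ℤ_[p]) (n : Fin 2 → ℕ) :
    ∃ y ∈ congrBox x n, Disjoint (congrBox y (n + 1)) S := by
  obtain ⟨V, hV, rfl⟩ := hS
  by_contra! H
  have hmem (y) (hy : y ∈ congrBox x n) : ∃ a b : ℤ_[p],
      (fun i => (((![y 0 + p ^ (n 0 + 1) * a, y 1 + p ^ (n 1 + 1) * b] i : ℤ_[p])) : ℚ_[p]))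
        ∈ V := by
    obtain ⟨l, hl, hlV⟩ := not_disjoint_iff.1 (H y hy)
    obtain ⟨a, ha⟩ := hl 0
    obtain ⟨b, hb⟩ := hl 1
    refine ⟨a, b, ?_⟩
    have hl' : (![y 0 + p ^ (n 0 + 1) * a, y 1 + p ^ (n 1 + 1) * b] : Fin 2 → ℤ_[p]) = l := by
      ext i
      fin_cases i
      · simpa using (sub_eq_iff_eq_add'.1 ha).symm
      · simpa using (sub_eq_iff_eq_add'.1 hb).symm
    rw [hl']
    exact hlV
  -- Three non-collinear corners, each perturbed one level deeper: dividing the collinearity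
  -- identity by `p ^ (n 0 + n 1)` gives `1 ≡ 0` modulo `p`.
  obtain ⟨a0, b0, h0⟩ := hmem x (mem_congrBox_self x n)
  obtain ⟨a1, b1, h1⟩ := hmem ![x 0 + p ^ n 0, x 1] (by simp [congrBox, Fin.forall_fin_two])
  obtain ⟨a2, b2, h2⟩ := hmem ![x 0, x 1 + p ^ n 1] (by simp [congrBox, Fin.forall_fin_two])
  have h := cross_eq_of_mem_line hV h0 h1 h2
  simp only [Matrix.cons_val_zero, Matrix.cons_val_one] at h
  norm_cast at h
  replace h := PadicInt.ext h
  push_cast at h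
  have hne : (p : ℤ_[p]) ^ n 0 * p ^ n 1 ≠ 0 := by
    have := (PadicInt.prime_p (p := p)).ne_zero
    positivity
  refine (PadicInt.prime_p (p := p)).not_isUnit (isUnit_of_dvd_one
    ⟨p * (b1 - b0) * (a2 - a0) - (a1 - a0) - (b2 - b0) - p * (a1 - a0) * (b2 - b0), ?_⟩)
  refine mul_left_cancel₀ hne ?_
  linear_combination h

end CongruenceBoxes

/-! ### The simplex lemma -/

section Simplex

variable {p : ℕ} [Fact p.Prime]

theorem exists_padicLine_of_cross_eq {P : Set (Fin 2 → ℤ_[p])}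
    (hP : ∀ a ∈ P, ∀ b ∈ P, ∀ c ∈ P,
      (b 0 - a 0) * (c 1 - a 1) = (b 1 - a 1) * (c 0 - a 0)) :
    ∃ S ∈ padicLines p, P ⊆ S := by
  let ι : (Fin 2 → ℤ_[p]) → Fin 2 → ℚ_[p] := fun y i => y i
  by_cases h : ∃ a ∈ P, ∃ b ∈ P, b ≠ a
  · obtain ⟨a, ha, b, hb, hab⟩ := h
    have hne : ι b - ι a ≠ 0 := by
      rw [sub_ne_zero]
      exact fun h => hab (funext fun i => PadicInt.ext (congrFun h i))
    refine ⟨_, ⟨AffineSubspace.mk' (ι a) (Submodule.span ℚ_[p] {ι b - ι a}), ?_, rfl⟩, ?_⟩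
    · rw [AffineSubspace.direction_mk', finrank_span_singleton hne]
    · intro c hc
      have hcr := congrArg (fun u : ℤ_[p] => (u : ℚ_[p])) (hP a ha b hb c hc)
      push_cast at hcr
      change ι c ∈ AffineSubspace.mk' (ι a) (Submodule.span ℚ_[p] {ι b - ι a})
      rw [AffineSubspace.mem_mk', vsub_eq_sub, Submodule.mem_span_singleton]
      by_cases h0 : ι b 0 - ι a 0 = 0
      · have h1 : ι b 1 - ι a 1 ≠ 0 := fun h1 => hne (by
          ext i
          fin_cases i
          exacts [h0, h1])
        have h2 : ι c 0 - ι a 0 = 0 := by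
          simp only [ι] at h0 h1 ⊢
          rw [h0, zero_mul, zero_eq_mul] at hcr
          exact hcr.resolve_left h1
        refine ⟨(ι c 1 - ι a 1) / (ι b 1 - ι a 1), ?_⟩
        ext i
        fin_cases i
        · simp [h0, h2]
        · simp [h1]
      · refine ⟨(ι c 0 - ι a 0) / (ι b 0 - ι a 0), ?_⟩
        ext i
        fin_cases i
        · simp [h0]
        · simp only [Pi.smul_apply, Pi.sub_apply, smul_eq_mul, Fin.mk_one]
          rw [div_mul_eq_mul_div, div_eq_iff h0]
          simp only [ι]
          linear_combination -hcr
  · push Not at h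
    obtain ⟨a, ha⟩ : ∃ a, P ⊆ {a} := by
      rcases P.eq_empty_or_nonempty with rfl | ⟨a, ha⟩
      · exact ⟨0, empty_subset _⟩
      · exact ⟨a, fun b hb => h a ha b hb⟩
    -- With at most one point any direction will do; here it is `(1, 1)`.
    refine ⟨_, ⟨AffineSubspace.mk' (ι a) (Submodule.span ℚ_[p] {1}), ?_, rfl⟩, ?_⟩
    · rw [AffineSubspace.direction_mk', finrank_span_singleton one_ne_zero]
    · intro c hc
      obtain rfl : c = a := ha hc
      exact AffineSubspace.self_mem_mk' (ι c) (Submodule.span ℚ_[p] {1})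

theorem Int.eq_zero_of_pow_dvd_padicInt {D : ℤ} {s : ℝ} (hD : |(D : ℝ)| < Real.exp s)
    (h : (p : ℤ_[p]) ^ ⌈s / Real.log p⌉₊ ∣ D) : D = 0 := by
  rw [PadicInt.pow_p_dvd_int_iff] at h
  refine Int.eq_zero_of_abs_lt_dvd h ?_
  have hp : (0 : ℝ) < p := by exact_mod_cast (Fact.out : p.Prime).pos
  have hlog := log_prime_pos p
  have : (|D| : ℝ) < (p : ℝ) ^ ⌈s / Real.log p⌉₊ := by
    refine hD.trans_le ?_
    rw [← Real.rpow_natCast, Real.rpow_def_of_pos hp, Real.exp_le_exp, ← div_le_iff₀' hlog]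
    exact Nat.le_ceil _
  exact_mod_cast this

/-- The rational points `z / q` of `ψ(x, t)` with height less than `exp t / 2`. -/
def lowRationals (r : Fin 2 → ℝ) (x : Fin 2 → ℤ_[p]) (t : ℝ) : Set (Fin 2 → ℤ_[p]) :=
  {y | y ∈ padicBox p r x t ∧ ∃ (z : Fin 2 → ℤ) (q : ℕ), 0 < q ∧
    (∀ i, (q : ℤ_[p]) * y i = z i) ∧
      max (max |(z 0 : ℝ)| |(z 1 : ℝ)|) |(q : ℝ)| < Real.exp t / 2}

theorem norm_sub_le_of_mem_padicBox {r : Fin 2 → ℝ} {x y z : Fin 2 → ℤ_[p]} {t : ℝ}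
    (hy : y ∈ padicBox p r x t) (hz : z ∈ padicBox p r x t) (i : Fin 2) :
    ‖z i - y i‖ ≤ Real.exp (-((1 + r i) * t)) := by
  rw [padicBox_eq_congrBox] at hy hz
  rw [PadicInt.norm_le_exp_iff_pow_dvd]
  have := dvd_sub (hz i) (hy i)
  rwa [sub_sub_sub_cancel_right] at this

theorem pow_dvd_mul_of_norm_le {a b : ℤ_[p]} {s t u : ℝ} (ha : ‖a‖ ≤ Real.exp (-s))
    (hb : ‖b‖ ≤ Real.exp (-t)) (hu : u = s + t) : (p : ℤ_[p]) ^ ⌈u / Real.log p⌉₊ ∣ a * b := by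
  rw [← PadicInt.norm_le_exp_iff_pow_dvd, norm_mul, hu, neg_add, Real.exp_add]
  gcongr

/-- The determinant of the integer rows `(q, z 0, z 1)` is the cross product times the denominators.
It is divisible to depth `3 * t`, because `(1 + r 0) + (1 + r 1) = 3`, while its absolute value is
at most `3! * (exp t / 2) ^ 3 < exp (3 * t)`. Hence it vanishes; the factor `1 / 2` in the height
bound is there to beat `3!`. -/
theorem lowRationals_cross_eq {r : Fin 2 → ℝ} (hsum : ∑ i, r i = 1) {x : Fin 2 → ℤ_[p]} {t : ℝ}
    {a b c : Fin 2 → ℤ_[p]} (ha : a ∈ lowRationals r x t) (hb : b ∈ lowRationals r x t)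
    (hc : c ∈ lowRationals r x t) :
    (b 0 - a 0) * (c 1 - a 1) = (b 1 - a 1) * (c 0 - a 0) := by
  obtain ⟨ha, z, q, hq, hz, hH⟩ := ha
  obtain ⟨hb, z', q', hq', hz', hH'⟩ := hb
  obtain ⟨hc, z'', q'', hq'', hz'', hH''⟩ := hc
  rw [Fin.sum_univ_two] at hsum
  let A : Matrix (Fin 3) (Fin 3) ℤ := !![q, z 0, z 1; q', z' 0, z' 1; q'', z'' 0, z'' 1]
  have hA : A.det = q * z' 0 * z'' 1 - q * z' 1 * z'' 0 - z 0 * q' * z'' 1 + z 0 * z' 1 * q''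
      + z 1 * q' * z'' 0 - z 1 * z' 0 * q'' := by
    simp [A, Matrix.det_fin_three]
  have hdet : ((A.det : ℤ) : ℤ_[p]) =
      q * q' * q'' * ((b 0 - a 0) * (c 1 - a 1) - (b 1 - a 1) * (c 0 - a 0)) := by
    rw [hA]
    push_cast
    rw [← hz, ← hz, ← hz', ← hz', ← hz'', ← hz'']
    ring
  have hdvd : (p : ℤ_[p]) ^ ⌈(3 * t) / Real.log p⌉₊ ∣ ((A.det : ℤ) : ℤ_[p]) := by
    rw [hdet]
    refine Dvd.dvd.mul_left (dvd_sub ?_ ?_) _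
    · exact pow_dvd_mul_of_norm_le (norm_sub_le_of_mem_padicBox ha hb 0)
        (norm_sub_le_of_mem_padicBox ha hc 1) (by linear_combination -t * hsum)
    · exact pow_dvd_mul_of_norm_le (norm_sub_le_of_mem_padicBox ha hb 1)
        (norm_sub_le_of_mem_padicBox ha hc 0) (by linear_combination -t * hsum)
  have hsmall : |(A.det : ℝ)| < Real.exp (3 * t) := by
    have h := Matrix.det_le (A := A.map (Int.cast : ℤ → ℝ)) (abv := AbsoluteValue.abs)
      (x := Real.exp t / 2) (by
        simp only [max_lt_iff] at hH hH' hH''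
        intro i j
        fin_cases i <;> fin_cases j <;> simp [A] <;> simp at hH hH' hH'' <;> linarith)
    have h3 : Real.exp (3 * t) = Real.exp t ^ 3 := by rw [← Real.exp_nat_mul]; norm_cast
    have hc : ((A.det : ℤ) : ℝ) = (A.map (Int.cast : ℤ → ℝ)).det := Int.cast_det A
    rw [hc, h3]
    refine h.trans_lt ?_
    have := pow_pos (Real.exp_pos t) 3
    norm_num [Nat.factorial, div_pow]
    linarith
  have h0 := Int.eq_zero_of_pow_dvd_padicInt hsmall hdvd
  rw [h0, Int.cast_zero, zero_eq_mul, sub_eq_zero] at hdet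
  refine hdet.resolve_left ?_
  norm_cast
  positivity

theorem exists_padicLine_lowRationals {r : Fin 2 → ℝ} (hsum : ∑ i, r i = 1)
    (x : Fin 2 → ℤ_[p]) (t : ℝ) : ∃ S ∈ padicLines p, lowRationals r x t ⊆ S :=
  exists_padicLine_of_cross_eq fun _ ha _ hb _ hc => lowRationals_cross_eq hsum ha hb hc

end Simplex

/-! ### The winning strategy -/

section Game

open AbsGame

variable {p : ℕ} [Fact p.Prime]

theorem isClosed_padicBox (r : Fin 2 → ℝ) (x : Fin 2 → ℤ_[p]) (t : ℝ) :
    IsClosed (padicBox p r x t) := by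
  have : padicBox p r x t =
      univ.pi fun i => Metric.closedBall (x i) (Real.exp (-(1 + r i) * t)) := by
    ext y
    simp [padicBox]
  rw [this]
  exact isClosed_set_pi fun i _ => Metric.isClosed_closedBall

theorem self_mem_padicBox (r : Fin 2 → ℝ) (x : Fin 2 → ℤ_[p]) (t : ℝ) : x ∈ padicBox p r x t :=
  padicBox_eq_congrBox r x t ▸ mem_congrBox_self x _

/-- In every box there is a box of exponents larger by one all of whose sub-boxes are legal moves
when a neighborhood of the line `S` is blocked. -/
theorem exists_congrBox_legal {r : Fin 2 → ℝ} (hr : ∀ i, 0 ≤ r i) {S : Set (Fin 2 → ℤ_[p])}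
    (hS : S ∈ padicLines p) {b : ℝ} (hb : Real.log p ≤ b) (x : Fin 2 → ℤ_[p]) {t : ℝ}
    (ht : 0 ≤ t) :
    ∃ y ∈ congrBox x (boxDepth p r t), ∀ y' ∈ congrBox y (boxDepth p r t + 1),
      padicBox p r y' (t + b) ⊆ padicBox p r x t \ nhd (padicBox p r) S (t + b) := by
  obtain ⟨y, hy, hyS⟩ := exists_congrBox_disjoint_padicLine hS x (boxDepth p r t)
  refine ⟨y, hy, fun y' hy' => ?_⟩
  have hsub : congrBox y' (boxDepth p r (t + b)) ⊆ congrBox y (boxDepth p r t + 1) :=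
    congrBox_subset_of_mem hy' (boxDepth_add_one_le hr ht hb)
  have hsub' : congrBox y (boxDepth p r t + 1) ⊆ congrBox x (boxDepth p r t) :=
    congrBox_subset_of_mem hy fun i => Nat.le_succ _
  simp only [padicBox_eq_congrBox, nhd]
  refine subset_sdiff.2 ⟨hsub.trans hsub', ?_⟩
  rw [disjoint_left]
  intro z hz hzS
  obtain ⟨l, hl, hzl⟩ := mem_iUnion₂.1 hzS
  refine disjoint_left.1 hyS (hsub ?_) hl
  rw [← congrBox_eq_of_mem hz]
  exact mem_congrBox_comm.1 hzl

theorem exp_neg_le_rpow {r s d : ℝ} (hr : 0 ≤ r) (h : Real.exp (-(1 + r) * s) < d) :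
    Real.exp (-s) ≤ d ^ (1 / (1 + r)) := by
  have h1 : Real.exp (-s) = Real.exp (-(1 + r) * s) ^ (1 / (1 + r)) := by
    rw [← Real.exp_mul]
    congr 1
    field_simp
  rw [h1]
  gcongr

theorem mem_padicBad_of_forall_notMem {r : Fin 2 → ℝ} (hr : ∀ i, 0 ≤ r i)
    {x : Fin 2 → ℤ_[p]} {t : ℕ → ℝ} {b : ℝ} (ht : Filter.Tendsto t Filter.atTop Filter.atTop)
    (hb : ∀ k, t (k + 1) ≤ t k + b) (hb0 : 0 ≤ b) (hx : ∀ k y, y ∈ lowRationals r x (t k) →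
      x ∉ padicBox p r y (t k + b)) : x ∈ padicBad p r := by
  -- The three terms serve, in order, non-integral `z / q`, heights already below `exp (t 0) / 2`,
  -- and all other heights.
  set c := min 1 (min (Real.exp (-(t 0 + b))) (Real.exp (-(2 * b)) / 2)) with hc
  have hc0 : 0 < c := by positivity
  refine ⟨c, hc0, fun z q hq => ?_⟩
  set H := max (max |(z 0 : ℝ)| |(z 1 : ℝ)|) |(q : ℝ)| with hHdef
  have hH1 : 1 ≤ H := by
    refine le_max_of_le_right ?_
    rw [Nat.abs_cast]
    exact_mod_cast hq
  have hqne : (q : ℚ_[p]) ≠ 0 := by exact_mod_cast hq.ne'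
  suffices h : ∃ i, c * H⁻¹ ≤ ‖(x i : ℚ_[p]) - z i / q‖ ^ (1 / (1 + r i)) by
    obtain ⟨i, hi⟩ := h
    fin_cases i
    · exact le_max_of_le_left hi
    · exact le_max_of_le_right hi
  by_cases hint : ∀ i, ‖(z i : ℚ_[p]) / q‖ ≤ 1
  · let y : Fin 2 → ℤ_[p] := fun i => ⟨z i / q, hint i⟩
    have hyz (i) : (q : ℤ_[p]) * y i = z i := by
      apply PadicInt.ext
      push_cast
      exact mul_div_cancel₀ _ hqne
    -- Take the first `k` whose height bound exceeds `H`. If `k = m + 1`, then `exp (t m) / 2 ≤ H`,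
    -- so `H` and `exp (t k)` agree up to a factor depending on `b`.
    obtain ⟨k, hk, hck⟩ : ∃ k, H < Real.exp (t k) / 2 ∧ c * H⁻¹ ≤ Real.exp (-(t k + b)) := by
      have hex : ∃ k, H < Real.exp (t k) / 2 :=
        (((Real.tendsto_exp_atTop.comp ht).atTop_div_const two_pos).eventually_gt_atTop H).exists
      classical
      refine ⟨Nat.find hex, Nat.find_spec hex, ?_⟩
      rcases Nat.eq_zero_or_pos (Nat.find hex) with h0 | h0
      · rw [h0]
        calc c * H⁻¹ ≤ c * 1 := by gcongr; exact inv_le_one_of_one_le₀ hH1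
          _ ≤ Real.exp (-(t 0 + b)) := by
            rw [mul_one]
            exact (min_le_right _ _).trans (min_le_left _ _)
      · obtain ⟨m, hm⟩ := Nat.exists_eq_succ_of_ne_zero h0.ne'
        have hlt := Nat.find_min hex (m := m) (by omega)
        rw [not_lt] at hlt
        rw [hm, Nat.succ_eq_add_one, ← div_eq_mul_inv, div_le_iff₀ (by positivity)]
        calc c ≤ Real.exp (-(2 * b)) / 2 := (min_le_right _ _).trans (min_le_right _ _)
          _ ≤ Real.exp (-(t (m + 1) + b)) * (Real.exp (t m) / 2) := by
            rw [← mul_div_assoc, ← Real.exp_add]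
            gcongr
            linarith [hb m]
          _ ≤ _ := by gcongr
    have hxy : x ∉ padicBox p r y (t k + b) := by
      by_cases hy : y ∈ padicBox p r x (t k)
      · exact hx k y ⟨hy, z, q, hq, hyz, hk⟩
      · rw [padicBox_eq_congrBox] at hy ⊢
        exact fun h => hy (mem_congrBox_comm.1
          (congrBox_anti _ (boxDepth_mono hr (by linarith)) h))
    simp only [padicBox, mem_ofPred_eq, not_forall, mem_closedBall_iff_norm, not_le] at hxy
    obtain ⟨i, hi⟩ := hxy
    refine ⟨i, hck.trans ?_⟩
    exact exp_neg_le_rpow (hr i) hi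
  · push Not at hint
    obtain ⟨i, hi⟩ := hint
    refine ⟨i, ?_⟩
    -- By the ultrametric inequality, a non-integral coordinate is at distance more than 1 from `x
    -- i`.
    have hlt : 1 < ‖(x i : ℚ_[p]) - z i / q‖ := by
      rw [sub_eq_add_neg, Padic.add_eq_max_of_ne, norm_neg]
      · exact lt_max_of_lt_right hi
      · rw [norm_neg]
        exact ((x i).2.trans_lt hi).ne
    calc c * H⁻¹ ≤ 1 * 1 := by
          gcongr
          exacts [min_le_left _ _, inv_le_one_of_one_le₀ hH1]
      _ = 1 := one_mul 1
      _ ≤ _ := Real.one_le_rpow hlt.le (by have := hr i; positivity)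

/-- A wins by blocking, after every move of B, a neighborhood of a line which contains all rational
points of low height of B's box. -/
theorem iInter_padicBox_inter_padicBad_nonempty {r : Fin 2 → ℝ} (hr : ∀ i, 0 ≤ r i)
    {S : FBall (Fin 2 → ℤ_[p]) → Set (Fin 2 → ℤ_[p])}
    (hS : ∀ ω, lowRationals r ω.1 ω.2 ⊆ S ω) {b₀ b : ℝ} (hb₀ : 0 < b₀) (hb : b₀ ≤ b)
    {ω : ℕ → FBall (Fin 2 → ℤ_[p])}
    (hω : ∀ k, ω (k + 1) ∈ legalMoves (padicBox p r) b₀ b (ω k)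
      (nhd (padicBox p r) (S (ω k)) ((ω k).2 + b))) :
    ((⋂ k, padicBox p r (ω k).1 (ω k).2) ∩ padicBad p r).Nonempty := by
  choose b' hb₀' hbb' hωt hωs using hω
  have hne : (⋂ k, padicBox p r (ω k).1 (ω k).2).Nonempty :=
    IsCompact.nonempty_iInter_of_sequence_nonempty_isCompact_isClosed _
      (fun k => (hωs k).trans sdiff_subset) (fun k => ⟨_, self_mem_padicBox _ _ _⟩)
      (isClosed_padicBox _ _ _).isCompact fun k => isClosed_padicBox _ _ _
  obtain ⟨x, hx⟩ := hne
  rw [mem_iInter] at hx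
  refine ⟨x, mem_iInter.2 hx, ?_⟩
  have hlow (k : ℕ) : b₀ * k ≤ (ω k).2 := by
    induction k with
    | zero => simpa using (ω 0).2.2.le
    | succ k ih =>
      rw [hωt k]
      push_cast
      linarith [hb₀' k]
  refine mem_padicBad_of_forall_notMem hr (t := fun k => (ω k).2) (b := b)
    (Filter.tendsto_atTop_mono hlow (tendsto_natCast_atTop_atTop.const_mul_atTop hb₀))
    (fun k => by rw [hωt k]; linarith [hbb' k]) (hb₀.le.trans hb) fun k y hy hxy => ?_
  -- The limit point lies in B's next box, which avoids the blocked set; as it also lies in the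
  -- current box, it can replace the center in `lowRationals`.
  refine (hωs k (hx (k + 1))).2 (mem_iUnion₂.2 ⟨y, hS _ ⟨?_, hy.2⟩, hxy⟩)
  have h1 := hy.1
  have h2 := hx k
  rw [padicBox_eq_congrBox] at h1 h2 ⊢
  rwa [← congrBox_eq_of_mem h2]

theorem isAbsWinning_padicBad {r : Fin 2 → ℝ} (hr : ∀ i, 0 ≤ r i) (hsum : ∑ i, r i = 1) :
    IsAbsWinning (padicBox p r) (padicLines p) (padicBad p r) := by
  choose S hS hlow using fun ω : FBall (Fin 2 → ℤ_[p]) =>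
    exists_padicLine_lowRationals hsum ω.1 (ω.2 : ℝ)
  have hlog := log_prime_pos p
  -- Adding `log p` to `t` raises both exponents by at least one, which is the room needed to avoid
  -- a line.
  refine ⟨Real.log p, hlog, fun b hb => ⟨fun k h =>
    nhd (padicBox p r) (S (h (Fin.last k))) ((h (Fin.last k)).2 + b), fun k h => ⟨?_, ?_⟩, ?_⟩⟩
  · exact Or.inr ⟨_, hS _, b, le_rfl, rfl⟩
  · dsimp only
    generalize h (Fin.last k) = ω
    obtain ⟨y, -, hy⟩ := exists_congrBox_legal hr (hS ω) hb ω.1 ω.2.2.le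
    exact ⟨(y, ⟨ω.2 + b, add_pos ω.2.2 (hlog.trans_le hb)⟩), b, hb, le_rfl, rfl,
      hy y (mem_congrBox_self _ _)⟩
  · exact fun ω hω => iInter_padicBox_inter_padicBad_nonempty hr hlow hlog hb hω

end Game

/-! ### Subdivision of boxes, Haar measure, and the upper bound for the dimension -/

section Subdivision

open MeasureTheory
open scoped ENNReal

theorem card_subboxes (p : ℕ) (d : Fin 2 → ℕ) :
    Fintype.card (∀ i, Fin (p ^ d i)) = p ^ ∑ i, d i := by
  simp [Finset.prod_pow_eq_pow_sum]

variable {p : ℕ} [Fact p.Prime]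

theorem edist_le_inv_pow_iff {x y : Fin 2 → ℤ_[p]} {m : ℕ} :
    edist y x ≤ (p : ℝ≥0∞)⁻¹ ^ m ↔ y ∈ congrBox x fun _ => m := by
  have hp : (0 : ℝ) < p := by exact_mod_cast (Fact.out : p.Prime).pos
  have hpow : (p : ℝ≥0∞)⁻¹ ^ m = ENNReal.ofReal ((p : ℝ) ^ (-m : ℤ)) := by
    rw [zpow_neg, zpow_natCast, ENNReal.ofReal_inv_of_pos (by positivity),
      ENNReal.ofReal_pow hp.le, ENNReal.ofReal_natCast, ENNReal.inv_pow]
  rw [edist_pi_le_iff]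
  refine forall_congr' fun i => ?_
  rw [hpow, edist_dist, dist_eq_norm, ENNReal.ofReal_le_ofReal_iff (by positivity),
    PadicInt.norm_le_pow_iff_pow_dvd]

theorem ediam_congrBox_le (x : Fin 2 → ℤ_[p]) (m : ℕ) :
    Metric.ediam (congrBox x fun _ => m) ≤ (p : ℝ≥0∞)⁻¹ ^ m := by
  refine Metric.ediam_le fun y hy z hz => edist_le_inv_pow_iff.2 ?_
  rwa [congrBox_eq_of_mem hz]

/-- The centers of the sub-boxes of exponents `n + d` of the box of exponents `n` about `x`. -/
noncomputable def subboxCenter (x : Fin 2 → ℤ_[p]) (n : Fin 2 → ℕ) {d : Fin 2 → ℕ}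
    (a : ∀ i, Fin (p ^ d i)) : Fin 2 → ℤ_[p] :=
  fun i => x i + (p : ℤ_[p]) ^ n i * ((a i : ℕ) : ℤ_[p])

theorem subboxCenter_mem (x : Fin 2 → ℤ_[p]) (n : Fin 2 → ℕ) {d : Fin 2 → ℕ}
    (a : ∀ i, Fin (p ^ d i)) : subboxCenter x n a ∈ congrBox x n :=
  fun i => by simp [subboxCenter]

theorem iUnion_congrBox_subboxCenter (x : Fin 2 → ℤ_[p]) (n d : Fin 2 → ℕ) :
    ⋃ a : ∀ i, Fin (p ^ d i), congrBox (subboxCenter x n a) (n + d) = congrBox x n := by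
  refine subset_antisymm (iUnion_subset fun a => congrBox_subset_of_mem (subboxCenter_mem x n a)
    fun i => Nat.le_add_right _ _) fun y hy => ?_
  choose u hu using hy
  refine mem_iUnion.2 ⟨fun i => ⟨(u i).appr (d i), PadicInt.appr_lt _ _⟩, fun i => ?_⟩
  have h := Ideal.mem_span_singleton.1 (PadicInt.appr_spec (d i) (u i))
  have h2 : y i - subboxCenter x n (fun i => ⟨(u i).appr (d i), PadicInt.appr_lt _ _⟩) i =
      (p : ℤ_[p]) ^ n i * (u i - (u i).appr (d i)) := by
    simp only [subboxCenter]
    linear_combination hu i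
  rw [h2, Pi.add_apply, pow_add]
  exact mul_dvd_mul_left _ h

theorem pairwise_disjoint_congrBox_subboxCenter (x : Fin 2 → ℤ_[p]) (n d : Fin 2 → ℕ) :
    Pairwise (Function.onFun Disjoint
      fun a : ∀ i, Fin (p ^ d i) => congrBox (subboxCenter x n a) (n + d)) := by
  intro a b hab
  refine disjoint_left.2 fun y hya hyb => hab (funext fun i => Fin.ext ?_)
  have h := dvd_sub (hyb i) (hya i)
  have h2 : y i - subboxCenter x n b i - (y i - subboxCenter x n a i) =
      (p : ℤ_[p]) ^ n i * (((a i : ℕ) - (b i : ℕ) : ℤ) : ℤ_[p]) := by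
    simp only [subboxCenter]
    push_cast
    ring
  rw [h2, Pi.add_apply, pow_add,
    mul_dvd_mul_iff_left (pow_ne_zero _ PadicInt.prime_p.ne_zero), PadicInt.pow_p_dvd_int_iff] at h
  have h3 : ((a i : ℕ) : ℤ) ≡ (b i : ℕ) [ZMOD ((p ^ d i : ℕ) : ℤ)] := by
    refine (Int.modEq_iff_dvd.2 ?_).symm
    exact_mod_cast h
  exact Nat.ModEq.eq_of_lt_of_lt (Int.natCast_modEq_iff.1 h3) (a i).2 (b i).2

theorem isClosed_congrBox (x : Fin 2 → ℤ_[p]) (n : Fin 2 → ℕ) : IsClosed (congrBox x n) := by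
  have : congrBox x n = univ.pi fun i => Metric.closedBall (x i) ((p : ℝ) ^ (-n i : ℤ)) := by
    ext y
    simp only [mem_univ_pi, mem_closedBall_iff_norm, PadicInt.norm_le_pow_iff_pow_dvd]
    rfl
  rw [this]
  exact isClosed_set_pi fun i _ => Metric.isClosed_closedBall

/-- The `p ^ (2 * m)` cubes of diameter at most `p ^ (-m)` have total 2-dimensional cost at most 1.
-/
theorem dimH_padicInt_sq_le (s : Set (Fin 2 → ℤ_[p])) : dimH s ≤ 2 := by
  borelize (Fin 2 → ℤ_[p])
  refine dimH_le_of_hausdorffMeasure_ne_top (d := 2) ?_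
  have hp1 : (1 : ℝ≥0∞) < p := by exact_mod_cast (Fact.out : p.Prime).one_lt
  refine ne_top_of_le_ne_top ENNReal.one_ne_top
    ((Measure.hausdorffMeasure_le_liminf_sum (ι := fun m : ℕ => ∀ _ : Fin 2, Fin (p ^ m))
      (2 : NNReal) s (fun m : ℕ => (p : ℝ≥0∞)⁻¹ ^ m)
      (ENNReal.tendsto_pow_atTop_nhds_zero_of_lt_one (ENNReal.inv_lt_one.2 hp1))
      (fun m a => congrBox (subboxCenter 0 0 a) fun _ => m)
      (.of_forall fun m a => ediam_congrBox_le _ m) (.of_forall fun m y _ => ?_)).trans ?_)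
  · have h := iUnion_congrBox_subboxCenter (0 : Fin 2 → ℤ_[p]) 0 fun _ => m
    rw [zero_add] at h
    rw [h]
    intro i
    simp
  · refine (Filter.liminf_le_liminf (.of_forall fun m => Finset.sum_le_sum fun a _ =>
      ENNReal.rpow_le_rpow (ediam_congrBox_le (subboxCenter 0 0 a) m) (by simp))).trans ?_
    refine (Filter.liminf_congr (.of_forall fun m => ?_)).trans_le
      (Filter.liminf_const (1 : ℝ≥0∞)).le
    rw [Finset.sum_const, Finset.card_univ, nsmul_eq_mul]
    have hcard : Fintype.card (Fin 2 → Fin (p ^ m)) = (p ^ m) ^ 2 := by simp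
    rw [hcard]
    push_cast
    rw [ENNReal.rpow_ofNat, ← ENNReal.inv_pow, ← mul_pow, ENNReal.mul_inv_cancel, one_pow]
    · exact pow_ne_zero _ (zero_lt_one.trans hp1).ne'
    · finiteness

variable [MeasurableSpace (Fin 2 → ℤ_[p])] [BorelSpace (Fin 2 → ℤ_[p])]

theorem measurableSet_congrBox (x : Fin 2 → ℤ_[p]) (n : Fin 2 → ℕ) :
    MeasurableSet (congrBox x n) :=
  (isClosed_congrBox x n).measurableSet

theorem measure_congrBox_eq_sum (ν : Measure (Fin 2 → ℤ_[p])) (x : Fin 2 → ℤ_[p])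
    (n d : Fin 2 → ℕ) :
    ν (congrBox x n) =
      ∑ a : ∀ i, Fin (p ^ d i), ν (congrBox (subboxCenter x n a) (n + d)) := by
  rw [← iUnion_congrBox_subboxCenter x n d,
    measure_iUnion (pairwise_disjoint_congrBox_subboxCenter x n d)
      fun a => measurableSet_congrBox _ _, tsum_fintype]

theorem exists_subbox_measure_le (ν : Measure (Fin 2 → ℤ_[p])) (x : Fin 2 → ℤ_[p])
    (n d : Fin 2 → ℕ) :
    ∃ y ∈ congrBox x n, ν (congrBox y (n + d)) * (p : ℝ≥0∞) ^ ∑ i, d i ≤ ν (congrBox x n) := by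
  have : ∀ i, NeZero (p ^ d i) := fun i => ⟨pow_ne_zero _ (Fact.out : p.Prime).ne_zero⟩
  obtain ⟨a, ha⟩ := Finite.exists_min
    fun a : ∀ i, Fin (p ^ d i) => ν (congrBox (subboxCenter x n a) (n + d))
  refine ⟨_, subboxCenter_mem x n a, ?_⟩
  calc _ = ∑ _a : ∀ i, Fin (p ^ d i), ν (congrBox (subboxCenter x n a) (n + d)) := by
        rw [Finset.sum_const, Finset.card_univ, card_subboxes p, nsmul_eq_mul, mul_comm]
        norm_cast
    _ ≤ _ := by
        rw [measure_congrBox_eq_sum ν x n d]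
        exact Finset.sum_le_sum fun b _ => ha b

/-- The normalized Haar measure of a box of exponents `n` is `p ^ -(n 0 + n 1)`. -/
theorem exists_measure_congrBox : ∃ μ : Measure (Fin 2 → ℤ_[p]), ∀ x n,
    μ (congrBox x n) = ((p : ℝ≥0∞) ^ ∑ i, n i)⁻¹ := by
  let μ : Measure (Fin 2 → ℤ_[p]) := Measure.addHaarMeasure ⊤
  have huniv : μ univ = 1 := Measure.addHaarMeasure_self (K₀ := ⊤)
  have htrans (x n) : μ (congrBox x n) = μ (congrBox 0 n) := by
    rw [← measure_preimage_add μ x (congrBox x n)]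
    congr 1
    ext y
    simp [congrBox]
  refine ⟨μ, fun x n => ENNReal.eq_inv_of_mul_eq_one_left ?_⟩
  have h0 : congrBox (0 : Fin 2 → ℤ_[p]) 0 = univ := by
    ext y
    simp [congrBox]
  have h := measure_congrBox_eq_sum μ 0 0 n
  simp only [zero_add, htrans (subboxCenter _ _ _)] at h
  rw [h0, huniv, Finset.sum_const, Finset.card_univ, card_subboxes p, nsmul_eq_mul] at h
  rw [h, htrans, mul_comm]
  norm_cast

end Subdivision

/-! ### The lower bound for the dimension -/

section Dimension

open AbsGame MeasureTheory
open scoped ENNReal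

variable {p : ℕ} [Fact p.Prime]

/-- Entering the line-free sub-box one level deeper costs a factor `p ^ 2` in density; from there
down to parameter `t + b`, averaging finds a sub-box at no further cost. The loss is thus
independent of `b`. -/
theorem exists_legal_measure_le [MeasurableSpace (Fin 2 → ℤ_[p])] [BorelSpace (Fin 2 → ℤ_[p])]
    {r : Fin 2 → ℝ} (hr : ∀ i, 0 ≤ r i) {S : Set (Fin 2 → ℤ_[p])} (hS : S ∈ padicLines p) {b : ℝ}
    (hb : Real.log p ≤ b) (ν : Measure (Fin 2 → ℤ_[p])) (x : Fin 2 → ℤ_[p]) {t : ℝ} (ht : 0 ≤ t) :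
    ∃ y, padicBox p r y (t + b) ⊆ padicBox p r x t \ nhd (padicBox p r) S (t + b) ∧
      ν (padicBox p r y (t + b)) * (p : ℝ≥0∞) ^ ∑ i, boxDepth p r (t + b) i ≤
        (p : ℝ≥0∞) ^ 2 * (ν (padicBox p r x t) * (p : ℝ≥0∞) ^ ∑ i, boxDepth p r t i) := by
  obtain ⟨y₀, hy₀, hy₀S⟩ := exists_congrBox_legal hr hS hb x ht
  set n := boxDepth p r t
  obtain ⟨d, hd⟩ := exists_add_of_le (boxDepth_add_one_le (p := p) hr ht hb)
  obtain ⟨y, hy, hyν⟩ := exists_subbox_measure_le ν y₀ (n + 1) d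
  refine ⟨y, hy₀S y hy, ?_⟩
  rw [padicBox_eq_congrBox, padicBox_eq_congrBox, hd]
  have hsum : ∑ i, (n + 1 + d) i = ∑ i, d i + 2 + ∑ i, n i := by
    simp only [Pi.add_apply, Pi.one_apply, Fin.sum_univ_two]
    ring
  rw [hsum, pow_add, pow_add, ← mul_assoc, ← mul_assoc]
  calc _ ≤ ν (congrBox y₀ (n + 1)) * (p : ℝ≥0∞) ^ 2 * (p : ℝ≥0∞) ^ ∑ i, n i := by gcongr
    _ ≤ ν (congrBox x n) * (p : ℝ≥0∞) ^ 2 * (p : ℝ≥0∞) ^ ∑ i, n i := by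
      gcongr
      exact congrBox_subset_of_mem hy₀ fun i => Nat.le_succ _
    _ = _ := by ring

/-- B can play against A's winning strategy so that the `ν`-density of the boxes grows at most by
the factor `p ^ 2` in each move. -/
theorem exists_mem_padicBad_measure_le [MeasurableSpace (Fin 2 → ℤ_[p])]
    [BorelSpace (Fin 2 → ℤ_[p])] {r : Fin 2 → ℝ} (hr : ∀ i, 0 ≤ r i) (hsum : ∑ i, r i = 1)
    {b : ℝ} (hb : Real.log p ≤ b) (ν : Measure (Fin 2 → ℤ_[p])) (x₀ : Fin 2 → ℤ_[p]) {t₀ : ℝ}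
    (ht₀ : 0 < t₀) :
    ∃ x ∈ padicBad p r ∩ padicBox p r x₀ t₀, ∀ k : ℕ,
      ν (padicBox p r x (t₀ + k * b)) * (p : ℝ≥0∞) ^ ∑ i, boxDepth p r (t₀ + k * b) i ≤
        (p : ℝ≥0∞) ^ (2 * k) *
          (ν (padicBox p r x₀ t₀) * (p : ℝ≥0∞) ^ ∑ i, boxDepth p r t₀ i) := by
  choose S hS hlow using fun ω : FBall (Fin 2 → ℤ_[p]) =>
    exists_padicLine_lowRationals hsum ω.1 (ω.2 : ℝ)
  have hlog := log_prime_pos p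
  choose f hf hfν using fun ω : FBall (Fin 2 → ℤ_[p]) =>
    exists_legal_measure_le hr (hS ω) hb ν ω.1 ω.2.2.le
  let ω : ℕ → FBall (Fin 2 → ℤ_[p]) := fun k =>
    Nat.rec (x₀, ⟨t₀, ht₀⟩) (fun _ ω => (f ω, ⟨ω.2 + b, add_pos ω.2.2 (hlog.trans_le hb)⟩)) k
  have hωt (k : ℕ) : ((ω k).2 : ℝ) = t₀ + k * b := by
    induction k with
    | zero => simp [ω]
    | succ k ih =>
      change ((ω k).2 : ℝ) + b = _
      rw [ih]
      push_cast
      ring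
  obtain ⟨x, hx, hxbad⟩ := iInter_padicBox_inter_padicBad_nonempty hr hlow hlog hb (ω := ω)
    fun k => ⟨b, hb, le_rfl, rfl, hf (ω k)⟩
  rw [mem_iInter] at hx
  refine ⟨x, ⟨hxbad, hx 0⟩, fun k => ?_⟩
  have hbox : padicBox p r x (t₀ + k * b) = padicBox p r (ω k).1 (ω k).2 := by
    have h := hx k
    rw [padicBox_eq_congrBox] at h ⊢
    rw [padicBox_eq_congrBox, ← hωt, congrBox_eq_of_mem h]
  rw [hbox, ← hωt]
  clear hbox
  induction k with
  | zero => simp [ω]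
  | succ k ih =>
    refine (hfν (ω k)).trans ?_
    rw [mul_add_one, pow_add, mul_comm (_ ^ (2 * k)), mul_assoc]
    gcongr

/-- Rounding the diameter up to a power of `p` costs at most `p ^ s`; the term `δ` pays for sets of
diameter zero. -/
theorem exists_congrBox_superset (T : Set (Fin 2 → ℤ_[p])) (hT : Metric.ediam T ≤ 1) {s : ℝ}
    (hs : 0 < s) {δ : ℝ≥0∞} (hδ : 0 < δ) :
    ∃ (x : Fin 2 → ℤ_[p]) (m : ℕ), T ⊆ (congrBox x fun _ => m) ∧
      ((p : ℝ≥0∞)⁻¹ ^ m) ^ s ≤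
        (p : ℝ≥0∞) ^ s * (⨆ _ : T.Nonempty, Metric.ediam T ^ s) + δ := by
  have hp1 : (1 : ℝ≥0∞) < p := by exact_mod_cast (Fact.out : p.Prime).one_lt
  have hp0 : (p : ℝ≥0∞) ≠ 0 := (zero_lt_one.trans hp1).ne'
  have hsub (x) (hx : x ∈ T) (m : ℕ) (hm : Metric.ediam T ≤ (p : ℝ≥0∞)⁻¹ ^ m) :
      T ⊆ congrBox x fun _ => m := fun y hy =>
    edist_le_inv_pow_iff.1 ((Metric.edist_le_ediam_of_mem hy hx).trans hm)
  by_cases hT0 : Metric.ediam T = 0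
  · obtain ⟨m, hm⟩ : ∃ m : ℕ, ((p : ℝ≥0∞)⁻¹ ^ m) ^ s < δ := by
      have h := (ENNReal.continuous_rpow_const (y := s)).tendsto 0 |>.comp
        (ENNReal.tendsto_pow_atTop_nhds_zero_of_lt_one (ENNReal.inv_lt_one.2 hp1))
      rw [ENNReal.zero_rpow_of_pos hs] at h
      exact (h.eventually (gt_mem_nhds hδ)).exists
    rcases T.eq_empty_or_nonempty with rfl | ⟨x, hx⟩
    · exact ⟨0, m, empty_subset _, hm.le.trans le_add_self⟩
    · exact ⟨x, m, hsub x hx m (hT0 ▸ zero_le), hm.le.trans le_add_self⟩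
  · obtain ⟨x, hx⟩ : T.Nonempty := by
      rw [nonempty_iff_ne_empty]
      rintro rfl
      simp at hT0
    obtain ⟨m, hm1, hm2⟩ : ∃ m : ℕ, (p : ℝ≥0∞)⁻¹ ^ (m + 1) < Metric.ediam T ∧
        Metric.ediam T ≤ (p : ℝ≥0∞)⁻¹ ^ m := by
      classical
      have hex : ∃ m : ℕ, (p : ℝ≥0∞)⁻¹ ^ (m + 1) < Metric.ediam T :=
        (((ENNReal.tendsto_pow_atTop_nhds_zero_of_lt_one
          (ENNReal.inv_lt_one.2 hp1)).comp (Filter.tendsto_add_atTop_nat 1)).eventually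
            (gt_mem_nhds (pos_iff_ne_zero.2 hT0))).exists
      refine ⟨Nat.find hex, Nat.find_spec hex, ?_⟩
      rcases h : Nat.find hex with _ | m
      · simpa using hT
      · exact not_lt.1 (Nat.find_min hex (m := m) (by omega))
    refine ⟨x, m, hsub x hx m hm2, le_add_right ?_⟩
    rw [iSup_pos ⟨x, hx⟩, ← ENNReal.mul_rpow_of_nonneg _ _ hs.le]
    gcongr
    calc (p : ℝ≥0∞)⁻¹ ^ m = p * (p : ℝ≥0∞)⁻¹ ^ (m + 1) := by
          rw [pow_succ', ← mul_assoc, ENNReal.mul_inv_cancel hp0 (by finiteness), one_mul]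
      _ ≤ _ := by gcongr

theorem exists_congrBox_cover [MeasurableSpace (Fin 2 → ℤ_[p])] [BorelSpace (Fin 2 → ℤ_[p])]
    {A : Set (Fin 2 → ℤ_[p])} {s : ℝ} (hs : 0 < s) (hA : Measure.hausdorffMeasure s A = 0)
    {ε : ℝ≥0∞} (hε : ε ≠ 0) :
    ∃ (x : ℕ → Fin 2 → ℤ_[p]) (m : ℕ → ℕ), A ⊆ ⋃ j, congrBox (x j) (fun _ => m j) ∧
      ∑' j, ((p : ℝ≥0∞)⁻¹ ^ m j) ^ s < ε := by
  have hε2 : ε / 2 ≠ 0 := (ENNReal.half_pos hε).ne'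
  have hps : (p : ℝ≥0∞) ^ s ≠ ⊤ := by finiteness
  obtain ⟨η, hη0, hη⟩ := ENNReal.exists_nnreal_pos_mul_lt hps hε2
  obtain ⟨δ, hδ0, hδ⟩ := ENNReal.exists_pos_sum_of_countable hε2 ℕ
  rw [Measure.hausdorffMeasure_apply] at hA
  have h1 : (⨅ (t : ℕ → Set (Fin 2 → ℤ_[p])) (_ : A ⊆ ⋃ n, t n)
      (_ : ∀ n, Metric.ediam (t n) ≤ 1),
        ∑' n, ⨆ _ : (t n).Nonempty, Metric.ediam (t n) ^ s) < η := by
    refine lt_of_le_of_lt ?_ (ENNReal.coe_pos.2 hη0)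
    rw [← hA]
    exact le_iSup₂_of_le 1 zero_lt_one le_rfl
  simp only [iInf_lt_iff] at h1
  obtain ⟨T, hAT, hT1, hTη⟩ := h1
  choose x m hsub hm using fun j => exists_congrBox_superset (T j) (hT1 j) hs
    (ENNReal.coe_pos.2 (hδ0 j))
  refine ⟨x, m, hAT.trans (iUnion_mono hsub), ?_⟩
  calc _ ≤ ∑' j, ((p : ℝ≥0∞) ^ s * (⨆ _ : (T j).Nonempty, Metric.ediam (T j) ^ s) + δ j) :=
        ENNReal.tsum_le_tsum hm
    _ = (p : ℝ≥0∞) ^ s * (∑' j, ⨆ _ : (T j).Nonempty, Metric.ediam (T j) ^ s) +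
        ∑' j, (δ j : ℝ≥0∞) := by rw [ENNReal.tsum_add, ENNReal.tsum_mul_left]
    _ < ε / 2 + ε / 2 := by
        refine ENNReal.add_lt_add (lt_of_le_of_lt ?_ hη) hδ
        rw [mul_comm]
        gcongr
    _ = ε := ENNReal.add_halves ε

theorem le_boxDepth_add_mul {r : Fin 2 → ℝ} (hr : ∀ i, 0 ≤ r i) {t : ℝ} (ht : 0 ≤ t) (n : ℕ)
    (i : Fin 2) : n ≤ boxDepth p r (t + n * Real.log p) i := by
  have hlog := log_prime_pos p
  refine Nat.cast_le.1 ((?_ : (n : ℝ) ≤ _).trans (Nat.le_ceil _))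
  rw [le_div_iff₀ hlog]
  have h1 : 0 ≤ (n : ℝ) * Real.log p := by positivity
  nlinarith [hr i]

theorem hausdorffMeasure_padicBad_inter_padicBox_ne_zero [MeasurableSpace (Fin 2 → ℤ_[p])]
    [BorelSpace (Fin 2 → ℤ_[p])] {r : Fin 2 → ℝ} (hr : ∀ i, 0 ≤ r i) (hsum : ∑ i, r i = 1)
    (x₀ : Fin 2 → ℤ_[p]) {t₀ : ℝ} (ht₀ : 0 < t₀) {M : ℕ} (hM : 1 < M) :
    Measure.hausdorffMeasure (2 - 2 / (M : ℝ)) (padicBad p r ∩ padicBox p r x₀ t₀) ≠ 0 := by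
  intro hzero
  have hp1 : (1 : ℝ≥0∞) < p := by exact_mod_cast (Fact.out : p.Prime).one_lt
  have hp0 : (p : ℝ≥0∞) ≠ 0 := (zero_lt_one.trans hp1).ne'
  have hpt : (p : ℝ≥0∞) ≠ ⊤ := by finiteness
  have hM1 : (1 : ℝ) < M := by exact_mod_cast hM
  have hM0 : (0 : ℝ) < M := by positivity
  have hlog := log_prime_pos p
  have hs : 0 < 2 - 2 / (M : ℝ) := by
    rw [sub_pos, div_lt_iff₀ hM0]
    linarith
  set D := ∑ i, boxDepth p r t₀ i
  obtain ⟨ε, hε0, hε⟩ := ENNReal.exists_nnreal_pos_mul_lt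
    (a := (p : ℝ≥0∞) ^ 2 * (p : ℝ≥0∞) ^ D) (b := 1) (by finiteness) one_ne_zero
  obtain ⟨x, m, hcov, hm⟩ := exists_congrBox_cover hs hzero (ENNReal.coe_pos.2 hε0).ne'
  obtain ⟨μ, hμ⟩ := exists_measure_congrBox (p := p)
  -- After `k j` moves of length `M * log p`, B's box has exponents at least `m j`, so it fits into
  -- the `j`-th cube if it meets it.
  let k : ℕ → ℕ := fun j => ⌈(m j : ℝ) / M⌉₊
  let ν : Measure (Fin 2 → ℤ_[p]) := Measure.sum fun j =>
    (p : ℝ≥0∞) ^ (2 * k j) • μ.restrict (congrBox (x j) fun _ => m j)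
  -- Since `2 * k j < 2 * m j / M + 2`, the weight raises the cost of a cube from exponent `2` to `2
  -- - 2/M`, up to `p ^ 2`.
  have hcost (j : ℕ) : (p : ℝ≥0∞) ^ (2 * k j) * μ (congrBox (x j) fun _ => m j) ≤
      (p : ℝ≥0∞) ^ 2 * ((p : ℝ≥0∞)⁻¹ ^ m j) ^ (2 - 2 / (M : ℝ)) := by
    rw [hμ, ← ENNReal.rpow_natCast, ← ENNReal.rpow_natCast, ← ENNReal.rpow_natCast,
      ← ENNReal.rpow_natCast, ← ENNReal.rpow_neg, ENNReal.inv_rpow, ← ENNReal.rpow_neg,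
      ← ENNReal.rpow_mul, ← ENNReal.rpow_add _ _ hp0 hpt, ← ENNReal.rpow_add _ _ hp0 hpt]
    refine ENNReal.rpow_le_rpow_of_exponent_le hp1.le ?_
    have hk : (k j : ℝ) < m j / M + 1 := Nat.ceil_lt_add_one (by positivity)
    simp only [Fin.sum_univ_two]
    push_cast
    have : (m j : ℝ) * (2 / M) = 2 * (m j / M) := by ring
    linarith
  have hν : ν (padicBox p r x₀ t₀) * (p : ℝ≥0∞) ^ D < 1 := by
    have hνuniv : ν univ ≤ (p : ℝ≥0∞) ^ 2 * ε := by
      rw [Measure.sum_apply _ MeasurableSet.univ]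
      simp only [Measure.smul_apply, smul_eq_mul, Measure.restrict_apply_univ]
      refine (ENNReal.tsum_le_tsum hcost).trans ?_
      rw [ENNReal.tsum_mul_left]
      gcongr
    calc _ ≤ (p : ℝ≥0∞) ^ 2 * ε * (p : ℝ≥0∞) ^ D := by
          gcongr
          exact (measure_mono (subset_univ _)).trans hνuniv
      _ = ε * ((p : ℝ≥0∞) ^ 2 * (p : ℝ≥0∞) ^ D) := by ring
      _ < 1 := hε
  obtain ⟨y, hy, hyk⟩ := exists_mem_padicBad_measure_le hr hsum (b := M * Real.log p)
    (by nlinarith) ν x₀ ht₀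
  obtain ⟨j, hj⟩ := mem_iUnion.1 (hcov hy)
  have hk := hyk (k j)
  have hkM : (m j : ℝ) ≤ k j * M := (div_le_iff₀ hM0).1 (Nat.le_ceil _)
  rw [padicBox_eq_congrBox] at hk
  set n := boxDepth p r (t₀ + k j * (M * Real.log p))
  have hsub : congrBox y n ⊆ congrBox (x j) fun _ => m j := by
    refine congrBox_subset_of_mem hj fun i => ?_
    refine (le_boxDepth_add_mul (p := p) hr ht₀.le (m j) i).trans (boxDepth_mono hr ?_ i)
    rw [← mul_assoc]
    gcongr
  -- Inside the `j`-th cube the density of `ν` is at least the weight `p ^ (2 * k j)`, whereas B's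
  -- play keeps it strictly below, as the initial density is less than 1.
  have hlow : (p : ℝ≥0∞) ^ (2 * k j) ≤ ν (congrBox y n) * (p : ℝ≥0∞) ^ ∑ i, n i := by
    calc (p : ℝ≥0∞) ^ (2 * k j)
        = (p : ℝ≥0∞) ^ (2 * k j) * μ (congrBox y n) * (p : ℝ≥0∞) ^ ∑ i, n i := by
          rw [hμ, mul_assoc, ENNReal.inv_mul_cancel (pow_ne_zero _ hp0) (by finiteness), mul_one]
      _ ≤ _ := by
          gcongr
          have h := Measure.le_sum_apply (fun j => (p : ℝ≥0∞) ^ (2 * k j) •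
            μ.restrict (congrBox (x j) fun _ => m j)) (congrBox y n)
          refine le_trans ?_ h
          refine le_trans ?_ (ENNReal.le_tsum j)
          rw [Measure.smul_apply, smul_eq_mul, Measure.restrict_apply (measurableSet_congrBox _ _),
            inter_eq_left.2 hsub]
  refine (hlow.trans hk).not_gt ?_
  calc _ < (p : ℝ≥0∞) ^ (2 * k j) * 1 := by
        gcongr
        finiteness
    _ = _ := mul_one _

theorem exists_padicBox_subset {r : Fin 2 → ℝ} (hr : ∀ i, 0 ≤ r i) {U : Set (Fin 2 → ℤ_[p])}
    (hU : IsOpen U) {x : Fin 2 → ℤ_[p]} (hx : x ∈ U) : ∃ t, 0 < t ∧ padicBox p r x t ⊆ U := by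
  obtain ⟨ε, hε, hεU⟩ := Metric.isOpen_iff.1 hU x hx
  obtain ⟨t, ht0, htε⟩ := ((Filter.eventually_gt_atTop 0).and
    (Real.tendsto_exp_neg_atTop_nhds_zero.eventually (gt_mem_nhds hε))).exists
  refine ⟨t, ht0, fun y hy => hεU ?_⟩
  rw [Metric.mem_ball, dist_pi_lt_iff hε]
  intro i
  refine (hy i).trans_lt (lt_of_le_of_lt ?_ htε)
  rw [Real.exp_le_exp]
  nlinarith [hr i]

theorem dimH_padicBad_inter {r : Fin 2 → ℝ} (hr : ∀ i, 0 ≤ r i) (hsum : ∑ i, r i = 1)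
    {U : Set (Fin 2 → ℤ_[p])} (hU : IsOpen U) (hne : U.Nonempty) :
    dimH (padicBad p r ∩ U) = 2 := by
  refine le_antisymm (dimH_padicInt_sq_le _) ?_
  borelize (Fin 2 → ℤ_[p])
  obtain ⟨x, hx⟩ := hne
  obtain ⟨t, ht, htU⟩ := exists_padicBox_subset hr hU hx
  have hlim : Filter.Tendsto (fun M : ℕ => ENNReal.ofReal (2 - 2 / (M : ℝ))) Filter.atTop
      (nhds 2) := by
    have h := ENNReal.tendsto_ofReal ((tendsto_const_nhds (x := (2 : ℝ))).sub
      (tendsto_const_div_atTop_nhds_zero_nat (2 : ℝ)))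
    simpa using h
  refine le_of_tendsto hlim ((Filter.eventually_gt_atTop 1).mono fun M hM => ?_)
  refine le_trans ?_ (dimH_mono (inter_subset_inter_right (padicBad p r) htU))
  refine le_dimH_of_hausdorffMeasure_ne_zero (d := (2 - 2 / (M : ℝ)).toNNReal) ?_
  have hM1 : (1 : ℝ) < M := by exact_mod_cast hM
  rw [Real.coe_toNNReal]
  · exact hausdorffMeasure_padicBad_inter_padicBox_ne_zero hr hsum x ht hM
  · rw [sub_nonneg, div_le_iff₀ (by positivity)]
    linarith

end Dimension

theorem theorem3p6 (p : ℕ) [Fact p.Prime] (r : Fin 2 → ℝ) (hr : ∀ i, 0 ≤ r i)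
    (hsum : ∑ i, r i = 1) :
    AbsGame.IsAbsWinning (padicBox p r) (padicLines p) (padicBad p r) ∧
      ∀ U : Set (Fin 2 → ℤ_[p]), IsOpen U → U.Nonempty → dimH (padicBad p r ∩ U) = 2 :=
  ⟨isAbsWinning_padicBad hr hsum, fun _ hU hne => dimH_padicBad_inter hr hsum hU hne⟩
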